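/- A finite-horizon Dec-POMDP $D$ consists of agents $\mathcal N=\{1,\dots,N\}$ ($N\ge 1$), a finite state set $\mathcal S$, finite action sets $\mathcal A_i$ and observation sets $\mathcal O_i$ ($i\in\mathcal N$), with $\mathcal A=\prod_i\mathcal A_i$ and $\mathcal O=\prod_i\mathcal O_i$, kernels $P(\cdot\mid s,a)\in\Delta(\mathcal S)$ and $O(\cdot\mid s,a)\in\Delta(\mathcal O)$, a reward $\mathcal R\colon\mathcal S\times\mathcal A\to\mathbb R$, an initial distribution $b_0\in\Delta(\mathcal S)$ and a horizon $T\in\mathbb N_0$. A local policy $\pi_i\in\Pi_i$ maps each local history $\tau_i\in\bigcup_{0\le t\le T}(\mathcal A_i\times\mathcal O_i)^t$ to an element $\pi_i(\cdot\mid\tau_i)$ of $\Delta(\mathcal A_i)$; a policy is an element $\pi$ of $\Pi=\prod_i\Pi_i$. Under $\mathbb P_\pi$ one has $S_0\sim b_0$, $S_{t+1}\sim P(\cdot\mid S_t,A_t)$, $O_{t+1}\sim O(\cdot\mid S_{t+1},A_t)$ and, independently over $i$, $A_{i,t}\sim\pi_i(\cdot\mid H_{i,t})$, where $H_{i,t}=(A_{i,0},O_{i,1},\dots,A_{i,t-1},O_{i,t})$.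 The self-play value is $J(\pi)=\mathbb E_\pi\big[\sum_{t=0}^T\mathcal R(S_t,A_t)\big]$. An automorphism $f\in\mathrm{Aut}(D)$ consists of bijections $\mathcal N\to\mathcal N$, $\mathcal S\to\mathcal S$, $\mathcal A_i\to\mathcal A_{f(i)}$, $\mathcal O_i\to\mathcal O_{f(i)}$ preserving $P$, $O$, $\mathcal R$ and $b_0$. It acts on policies by $(f^*\pi)_i(a_i\mid\tau_i)=\pi_{f^{-1}i}(f^{-1}a_i\mid f^{-1}\tau_i)$; $\pi$ is invariant to automorphism if $f^*\pi=\pi$ for all $f\in\mathrm{Aut}(D)$. For $g\in\mathrm{Aut}(D)^{\mathcal N}$ let $(g^*\pi)_i=(g_i^*\pi)_i$. The other-play value is $J_{\mathrm{OP}}(\pi)=\mathbb E_{g\sim\mathcal U(\mathrm{Aut}(D)^{\mathcal N})}[J(g^*\pi)]$, and the other-play distribution of $\pi$ is $\mu=|\mathrm{Aut}(D)|^{-N}\sum_{g\in\mathrm{Aut}(D)^{\mathcal N}}\delta_{g^*\pi}$, with marginals $\mu_i$ on $\Pi_i$. For a distribution $\nu$ on $\Pi$ let $\mathbb P_\nu$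 be the law obtained by drawing a policy from $\nu$ and then an episode from it. The symmetrized policy $\Psi(\pi)$ is the policy corresponding to $\mu$: for $0\le t\le T$ and $\tau_i\in(\mathcal A_i\times\mathcal O_i)^t$, $$\Psi(\pi)_i(a_i\mid\tau_i)=\mathbb P_{\mu_i\otimes\mu_{-i}}(A_{i,t}=a_i\mid H_{i,t}=\tau_i),$$ where $\mu_{-i}$ is any product of distributions over the local policies of the other agents with $\mathbb P_{\mu_i\otimes\mu_{-i}}(H_{i,t}=\tau_i)>0$, and $\Psi(\pi)_i(a_i\mid\tau_i)=1/|\mathcal A_i|$ if there is none. Policies $\pi,\pi'$ are equivalent if $\Psi(\pi)=\Psi(\pi')$. **Theorem.** Let $D$ be a Dec-POMDP. For every policy $\pi$, the policy $\Psi(\pi)$ is well defined (it does not depend on the choice of the $\mu_{-i}$) and invariant to automorphism, and $$J_{\mathrm{OP}}(\pi)=J(\Psi(\pi)).$$ In particular, $J_{\mathrm{OP}}$ factors through the equivalence classes of policies, and if $J_{\mathrm{OP}}$ has a maximizer over $\Pi$, then it has a maximizer that is invariant to automorphism. -/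

import Mathlib

open MeasureTheory ProbabilityTheory

universe u v w

/-- The σ-algebra on probability mass functions generated by the evaluations `p ↦ p a`. For finite
`α` it is the Borel σ-algebra of the simplex `Δ(α) ⊆ [0,1]^α`. -/
instance PMF.instMeasurableSpaceEval {α : Type u} : MeasurableSpace (PMF α) :=
  MeasurableSpace.comap (fun p a => p a) MeasurableSpace.pi

theorem PMF.measurable_eval {α : Type u} (a : α) : Measurable (fun p : PMF α => p a) :=
  (measurable_pi_apply a).comp (comap_measurable (fun (p : PMF α) a => p a))

/-- The product of finitely many probability mass functions on finite types. -/
noncomputable def PMF.piFintype {ι : Type u} [Fintype ι] [DecidableEq ι] {α : ι → Type v}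
    [∀ i, Fintype (α i)] (p : ∀ i, PMF (α i)) : PMF (∀ i, α i) :=
  PMF.ofFintype (fun a => ∏ i, p i (a i)) (by
    have h := Finset.prod_univ_sum (fun i : ι => (Finset.univ : Finset (α i))) (fun i a => p i a)
    rw [Fintype.piFinset_univ] at h
    rw [← h]
    refine Finset.prod_eq_one fun i _ => ?_
    rw [← tsum_fintype (L := SummationFilter.unconditional _), (p i).tsum_coe])

/-- A finite-horizon decentralized partially observable Markov decision problem. -/
structure DecPOMDP where
  /-- the number of agents; the agents are the elements of `Fin N` -/
  N : ℕ
  N_pos : 0 < N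
  /-- states -/
  S : Type u
  fintypeS : Fintype S
  /-- actions of each agent -/
  A : Fin N → Type v
  fintypeA : ∀ i, Fintype (A i)
  /-- observations of each agent -/
  O : Fin N → Type w
  fintypeO : ∀ i, Fintype (O i)
  /-- transition kernel `P(· ∣ s, a)` -/
  trans : S → (∀ i, A i) → PMF S
  /-- joint reward function `R(s, a)` -/
  reward : S → (∀ i, A i) → ℝ
  /-- observation kernel `O(· ∣ s, a)`: `s` is the new state and `a` the previous joint action -/
  obs : S → (∀ i, A i) → PMF (∀ i, O i)
  /-- initial state distribution -/
  b₀ : PMF S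
  /-- horizon; the time steps are `0, …, T` -/
  T : ℕ

namespace DecPOMDP

attribute [instance] DecPOMDP.fintypeS DecPOMDP.fintypeA DecPOMDP.fintypeO

variable (D : DecPOMDP.{u, v, w})

abbrev Agent : Type := Fin D.N

abbrev JointAction : Type v := ∀ i, D.A i

abbrev JointObs : Type w := ∀ i, D.O i

/-- Local action-observation histories of agent `i` of length `t`; entry `k` is the pair
`(a_{i,k}, o_{i,k+1})`. -/
abbrev LocalHist (i : D.Agent) (t : ℕ) : Type (max v w) := Fin t → D.A i × D.O i

/-- Local stochastic policies of agent `i`, defined on the local histories of length `t ≤ T`. -/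
abbrev LocalPolicy (i : D.Agent) : Type (max v w) :=
  ∀ t : Fin (D.T + 1), D.LocalHist i t → PMF (D.A i)

/-- Joint stochastic policies. -/
abbrev Policy : Type (max v w) := ∀ i, D.LocalPolicy i

/-! ### The process induced by a joint policy -/

/-- Histories up to step `t`: states `s_0, …, s_t`, joint actions `a_0, …, a_t`, and joint
observations `o_1, …, o_t` (`o_{k+1}` has index `k`). Rewards are functions of states and actions. -/
abbrev Hist (t : ℕ) : Type (max u v w) :=
  (Fin (t + 1) → D.S) × (Fin (t + 1) → D.JointAction) × (Fin t → D.JointObs)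

/-- The law of the history `H_t` under the joint policy `π`, by sampling
`S_0 ∼ b₀`, `A_{i,0} ∼ π_i(· ∣ ∅)`, `S_{t+1} ∼ P(· ∣ S_t, A_t)`, `O_{t+1} ∼ O(· ∣ S_{t+1}, A_t)`,
`A_{i,t+1} ∼ π_i(· ∣ A_{i,0}, O_{i,1}, …, A_{i,t}, O_{i,t+1})`, independently over the agents. -/
noncomputable def histLaw (π : D.Policy) : (t : ℕ) → t < D.T + 1 → PMF (D.Hist t)
  | 0, h =>
    D.b₀.bind fun s =>
      (PMF.piFintype fun i => π i ⟨0, h⟩ Fin.elim0).bind fun a =>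
        PMF.pure (fun _ => s, fun _ => a, Fin.elim0)
  | t + 1, h =>
    (histLaw π t (Nat.lt_of_succ_lt h)).bind fun τ =>
      (D.trans (τ.1 (Fin.last t)) (τ.2.1 (Fin.last t))).bind fun s =>
        (D.obs s (τ.2.1 (Fin.last t))).bind fun o =>
          (PMF.piFintype fun i => π i ⟨t + 1, h⟩ fun k =>
              (τ.2.1 k i, (Fin.snoc τ.2.2 o : Fin (t + 1) → D.JointObs) k i)).bind fun a =>
            PMF.pure (Fin.snoc τ.1 s, Fin.snoc τ.2.1 a, Fin.snoc τ.2.2 o)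

/-- Complete histories (episodes); this is the sample space `Ω`, with all subsets measurable. -/
def History : Type (max u v w) := D.Hist D.T

noncomputable instance : Fintype D.History := inferInstanceAs (Fintype (D.Hist D.T))

instance : MeasurableSpace D.History := ⊤

/-- The distribution `ℙ_π` of the episode under the joint policy `π`. -/
noncomputable def law (π : D.Policy) : PMF D.History := D.histLaw π D.T (Nat.lt_succ_self _)

variable {D}

/-- The random variable `S_t`. -/
def History.state (τ : D.History) (t : Fin (D.T + 1)) : D.S := τ.1 t

/-- The random variable `A_t`. -/
def History.action (τ : D.History) (t : Fin (D.T + 1)) : D.JointAction := τ.2.1 t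

/-- The random variable `O_{k+1}`. -/
def History.observation (τ : D.History) (k : Fin D.T) : D.JointObs := τ.2.2 k

/-- The action-observation history of agent `i` at step `t`,
`(A_{i,0}, O_{i,1}, …, A_{i,t-1}, O_{i,t})`. -/
def History.localHist (τ : D.History) (i : D.Agent) (t : Fin (D.T + 1)) : D.LocalHist i t :=
  fun k => (τ.action ⟨k, k.2.trans t.2⟩ i, τ.observation ⟨k, by omega⟩ i)

/-- The return `∑_{t=0}^T R_t`. -/
noncomputable def History.totalReward (τ : D.History) : ℝ :=
  ∑ t : Fin (D.T + 1), D.reward (τ.state t) (τ.action t)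

variable (D)

/-- The self-play objective: the expected return of a joint policy. -/
noncomputable def J (π : D.Policy) : ℝ := ∫ τ, τ.totalReward ∂(D.law π).toMeasure

/-! ### Automorphisms -/

/-- Automorphisms of a Dec-POMDP. `Equiv.piCongr` gives the induced bijection on joint actions,
`(f a)_{f i} = f_{A_i} a_i`, and likewise on joint observations. -/
structure Aut where
  onAgent : D.Agent ≃ D.Agent
  onState : D.S ≃ D.S
  onAction : ∀ i, D.A i ≃ D.A (onAgent i)
  onObs : ∀ i, D.O i ≃ D.O (onAgent i)
  trans_eq : ∀ (s s' : D.S) (a : D.JointAction),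
    D.trans s a s' = D.trans (onState s) (onAgent.piCongr onAction a) (onState s')
  obs_eq : ∀ (s : D.S) (a : D.JointAction) (o : D.JointObs),
    D.obs s a o = D.obs (onState s) (onAgent.piCongr onAction a) (onAgent.piCongr onObs o)
  reward_eq : ∀ (s : D.S) (a : D.JointAction),
    D.reward s a = D.reward (onState s) (onAgent.piCongr onAction a)
  b₀_eq : ∀ s : D.S, D.b₀ s = D.b₀ (onState s)

/-- The identity automorphism. -/
instance : Nonempty D.Aut :=
  ⟨{ onAgent := Equiv.refl _
     onState := Equiv.refl _
     onAction := fun _ => Equiv.refl _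
     onObs := fun _ => Equiv.refl _
     trans_eq := fun _ _ _ => rfl
     obs_eq := fun _ _ _ => rfl
     reward_eq := fun _ _ => rfl
     b₀_eq := fun _ => rfl }⟩

instance : Finite D.Aut :=
  Finite.of_injective
    (β := Σ e : D.Agent ≃ D.Agent,
      (D.S ≃ D.S) × (∀ i, D.A i ≃ D.A (e i)) × (∀ i, D.O i ≃ D.O (e i)))
    (fun f => ⟨f.onAgent, f.onState, f.onAction, f.onObs⟩) (by
      rintro ⟨a, b, c, d, _, _, _, _⟩ ⟨a', b', c', d', _, _, _, _⟩ h
      obtain ⟨rfl, h⟩ := Sigma.mk.inj_iff.mp h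
      have h := eq_of_heq h
      simp only [Prod.mk.injEq] at h
      obtain ⟨rfl, rfl, rfl⟩ := h
      rfl)

noncomputable instance : Fintype D.Aut := Fintype.ofFinite _

variable {D}

/-- Transport of a local policy of agent `i` to agent `f i`:
`(a ∣ τ) ↦ σ(f⁻¹ a ∣ f⁻¹ τ)`, where `f⁻¹` acts on local histories elementwise. -/
noncomputable def Aut.pushLocal (f : D.Aut) (i : D.Agent) (σ : D.LocalPolicy i) :
    D.LocalPolicy (f.onAgent i) :=
  fun t h => (σ t fun k => ((f.onAction i).symm (h k).1, (f.onObs i).symm (h k).2)).map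
    (f.onAction i)

/-- The pushforward policy `f^*π`, given by `(f^*π)_{f i}(f a ∣ f τ) = π_i(a ∣ τ)`, that is,
`(f^*π)_i(a ∣ τ) = π_{f⁻¹ i}(f⁻¹ a ∣ f⁻¹ τ)`. -/
noncomputable def Aut.push (f : D.Aut) (π : D.Policy) : D.Policy :=
  Equiv.piCongrLeft D.LocalPolicy f.onAgent fun i => f.pushLocal i (π i)

theorem Aut.push_apply (f : D.Aut) (π : D.Policy) (i : D.Agent) (t : Fin (D.T + 1))
    (h : D.LocalHist i t) (a : D.A i) :
    f.push π (f.onAgent i) t (fun k => (f.onAction i (h k).1, f.onObs i (h k).2))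
      (f.onAction i a) = π i t h a := by
  classical
  rw [Aut.push, Equiv.piCongrLeft_apply_apply, Aut.pushLocal, PMF.map_apply]
  simp

/-- A policy is invariant to automorphism if `f^*π = π` for every automorphism `f`. -/
def IsInvariant (π : D.Policy) : Prop := ∀ f : D.Aut, f.push π = π

/-- For a profile `g` of automorphisms, agent `i` in `g^*π` uses the local policy of agent `i` in
`(g_i)^*π`. -/
noncomputable def pushProfile (g : D.Agent → D.Aut) (π : D.Policy) : D.Policy :=
  fun i => (g i).push π i

variable (D)

/-- The other-play objective: the expectation of `J (g^*π)` over a uniformly distributed profile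
of automorphisms. -/
noncomputable def JOP (π : D.Policy) : ℝ :=
  (∑ g : D.Agent → D.Aut, D.J (pushProfile g π)) / Fintype.card (D.Agent → D.Aut)

/-- Maximizers of the other-play objective. -/
def IsOPOptimal (π : D.Policy) : Prop := ∀ π' : D.Policy, D.JOP π' ≤ D.JOP π

/-! ### Policies corresponding to distributions over policies -/

theorem measurable_histLaw (t : ℕ) (ht : t < D.T + 1) (τ : D.Hist t) :
    Measurable fun π : D.Policy => D.histLaw π t ht τ := by
  classical
  have key : ∀ (t : Fin (D.T + 1)) (h : ∀ i, D.LocalHist i t) (a : D.JointAction),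
      Measurable fun π : D.Policy => PMF.piFintype (fun i => π i t (h i)) a := by
    intro t h a
    simp only [PMF.piFintype, PMF.ofFintype_apply]
    refine Finset.measurable_prod _ fun i _ => ?_
    refine (PMF.measurable_eval (a i)).comp ?_
    exact (measurable_pi_apply (h i)).comp ((measurable_pi_apply t).comp (measurable_pi_apply i))
  induction t with
  | zero =>
    simp only [histLaw, PMF.bind_apply, tsum_fintype]
    refine Finset.measurable_sum _ fun s _ => measurable_const.mul ?_
    refine Finset.measurable_sum _ fun a _ => Measurable.mul ?_ measurable_const
    exact key ⟨0, ht⟩ _ a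
  | succ t ih =>
    simp only [histLaw, PMF.bind_apply, tsum_fintype]
    refine Finset.measurable_sum _ fun τ' _ => (ih _ τ').mul ?_
    refine Finset.measurable_sum _ fun s _ => measurable_const.mul ?_
    refine Finset.measurable_sum _ fun o _ => measurable_const.mul ?_
    refine Finset.measurable_sum _ fun a _ => Measurable.mul ?_ measurable_const
    exact key ⟨t + 1, ht⟩ _ a

/-- The Markov kernel `π ↦ ℙ_π` from joint policies to episodes. -/
noncomputable def episodeKernel : Kernel D.Policy D.History where
  toFun π := (D.law π).toMeasure
  measurable' := by
    refine Measure.measurable_of_measurable_coe _ fun s hs => ?_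
    simp only [PMF.toMeasure_apply_fintype _ s]
    refine Finset.measurable_sum _ fun τ _ => ?_
    by_cases h : τ ∈ s
    · simp only [Set.indicator_of_mem h]
      exact D.measurable_histLaw D.T (Nat.lt_succ_self _) τ
    · simp [h]

instance : IsMarkovKernel D.episodeKernel :=
  ⟨fun π => inferInstanceAs (IsProbabilityMeasure (D.law π).toMeasure)⟩

/-- The measure `ℙ_μ` on `Π × Ω`: a joint policy is drawn from `μ` and an episode is played with
it, i.e. `ℙ_μ(Z × Q) = 𝔼_{π ∼ μ}[1_Z(π) ℙ_π(Q)]`. -/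
noncomputable def mixLaw (μ : ProbabilityMeasure D.Policy) : Measure (D.Policy × D.History) :=
  (μ : Measure D.Policy) ⊗ₘ D.episodeKernel

instance (μ : ProbabilityMeasure D.Policy) : IsProbabilityMeasure (D.mixLaw μ) :=
  inferInstanceAs (IsProbabilityMeasure ((μ : Measure D.Policy) ⊗ₘ D.episodeKernel))

variable {D}

/-- The distribution `μ_i ⊗ μ_{-i}` over joint policies, where `μ_{-i} = ⨂_{j ≠ i} ν_j` has
independent local policies (the component `ν_i` is not used). -/
noncomputable def withOpponents (i : D.Agent) (μi : ProbabilityMeasure (D.LocalPolicy i))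
    (ν : ∀ j, ProbabilityMeasure (D.LocalPolicy j)) : ProbabilityMeasure D.Policy :=
  ⟨Measure.pi fun j => (Function.update ν i μi j : Measure (D.LocalPolicy j)), inferInstance⟩

/-- The event that the action-observation history of agent `i` at step `t` is `h`. -/
def histEvent (i : D.Agent) (t : Fin (D.T + 1)) (h : D.LocalHist i t) :
    Set (D.Policy × D.History) := {x | x.2.localHist i t = h}

/-- The event that agent `i` plays `a` at step `t`. -/
def actionEvent (i : D.Agent) (t : Fin (D.T + 1)) (a : D.A i) :
    Set (D.Policy × D.History) := {x | x.2.action t i = a}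

theorem sum_cond_actionEvent (μ : ProbabilityMeasure D.Policy) (i : D.Agent)
    (t : Fin (D.T + 1)) (h : D.LocalHist i t) (hh : D.mixLaw μ (histEvent i t h) ≠ 0) :
    ∑ a, (D.mixLaw μ)[actionEvent i t a | histEvent i t h] = 1 := by
  have := cond_isProbabilityMeasure hh
  have hm : ∀ a, MeasurableSet (actionEvent (D := D) i t a) := fun a =>
    measurable_snd (t := {τ : D.History | τ.action t i = a}) trivial
  have hsum := sum_measure_preimage_singleton (μ := (D.mixLaw μ)[|histEvent i t h])
    (Finset.univ : Finset (D.A i)) (f := fun x : D.Policy × D.History => x.2.action t i)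
    (fun a _ => hm a)
  refine Eq.trans hsum ?_
  simp

theorem nonempty_action (i : D.Agent) (μi : ProbabilityMeasure (D.LocalPolicy i)) :
    Nonempty (D.A i) := by
  obtain ⟨σ⟩ := μi.nonempty
  exact ⟨(σ 0 Fin.elim0).support_nonempty.some⟩

open Classical in
/-- The local policy corresponding to a distribution `μ_i` over local policies of agent `i`: the
conditional probability `ℙ_{μ_i ⊗ μ_{-i}}(A_{i,t} = a ∣ AO_{i,t} = h)`, for some `μ_{-i}` with
independent local policies under which `h` has positive probability, and the uniform distribution
if there is no such `μ_{-i}`. -/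
noncomputable def behaviourLocal (i : D.Agent) (μi : ProbabilityMeasure (D.LocalPolicy i)) :
    D.LocalPolicy i := fun t h =>
  if hex : ∃ ν, D.mixLaw (withOpponents i μi ν) (histEvent i t h) ≠ 0 then
    PMF.ofFintype
      (fun a => (D.mixLaw (withOpponents i μi hex.choose))[actionEvent i t a | histEvent i t h])
      (sum_cond_actionEvent _ i t h hex.choose_spec)
  else
    haveI := nonempty_action i μi
    PMF.uniformOfFintype (D.A i)

/-- The marginal `μ_i` of a distribution over joint policies. -/
noncomputable def marginal (μ : ProbabilityMeasure D.Policy) (i : D.Agent) :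
    ProbabilityMeasure (D.LocalPolicy i) :=
  μ.map (f := fun π => π i) (measurable_pi_apply i).aemeasurable

/-- The joint policy `π^μ` corresponding to a distribution over joint policies. -/
noncomputable def behaviour (μ : ProbabilityMeasure D.Policy) : D.Policy :=
  fun i => behaviourLocal i (marginal μ i)

/-- `ρ` is the joint policy corresponding to `μ`, whichever opponent distributions are used to
compute the conditional probabilities. -/
def Corresponds (μ : ProbabilityMeasure D.Policy) (ρ : D.Policy) : Prop :=
  ∀ (i : D.Agent) (t : Fin (D.T + 1)) (h : D.LocalHist i t),
    (∀ ν, D.mixLaw (withOpponents i (marginal μ i) ν) (histEvent i t h) ≠ 0 →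
      ∀ a, ρ i t h a =
        (D.mixLaw (withOpponents i (marginal μ i) ν))[actionEvent i t a | histEvent i t h]) ∧
    ((∀ ν, D.mixLaw (withOpponents i (marginal μ i) ν) (histEvent i t h) = 0) →
      ∀ a, ρ i t h a = (Fintype.card (D.A i) : ENNReal)⁻¹)

/-! ### The other-play distribution and the symmetrizer -/

/-- The other-play distribution `|Aut(D)|^{-N} ∑_g δ_{g^*π}` of a joint policy. -/
noncomputable def opDist (π : D.Policy) : ProbabilityMeasure D.Policy :=
  ⟨((Fintype.card D.Aut : ENNReal) ^ D.N)⁻¹ •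
      ∑ g : D.Agent → D.Aut, Measure.dirac (pushProfile g π), ⟨by
    have h0 : (Fintype.card D.Aut : ENNReal) ≠ 0 := by simp
    simp only [Measure.smul_apply, Measure.coe_finsetSum, Finset.sum_apply, measure_univ,
      Finset.sum_const, Finset.card_univ, Fintype.card_pi, Finset.prod_const, Fintype.card_fin,
      smul_eq_mul, nsmul_eq_mul, mul_one, Nat.cast_pow]
    exact ENNReal.inv_mul_cancel (pow_ne_zero _ h0) (ENNReal.pow_ne_top (by simp))⟩⟩

/-- The symmetrizer `Ψ`. -/
noncomputable def symmetrizer (π : D.Policy) : D.Policy := behaviour (opDist π)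

variable (D)

/-- Two joint policies are equivalent if they have the same image under the symmetrizer. -/
noncomputable def opSetoid : Setoid D.Policy := Setoid.ker symmetrizer

end DecPOMDP

/-! The probability of a history factors into a weight contributed by the environment and, for each
agent, the product of the probabilities of its actions under its local policy. By Kuhn's theorem,
independent random local policies therefore induce the same law of the episode as a joint policy
whose components select actions with the averaged weights. Conditional action probabilities given
a local history of agent `i` are read off the `i`-th of these components, whatever the opponents.

The other-play distribution is a product distribution, since the automorphisms of a profile are
independent, and so its expected return is the return of the corresponding joint policy. Composing
with a fixed automorphism permutes the uniformly distributed one, so automorphisms permute the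
marginals, and the symmetrized policy is invariant. -/

section ProbabilityMassFunctions

variable {α β : Type*}

theorem pmf_map_apply_of_injective {f : α → β} (hf : f.Injective) (p : PMF α) (a : α) :
    p.map f (f a) = p a := by
  classical
  simp [PMF.map_apply, hf.eq_iff]

theorem pmf_bind_map_prodMk_apply (p : PMF α) (q : α → PMF β) (a : α) (b : β) :
    (p.bind fun a => (q a).map (Prod.mk a)) (a, b) = p a * q a b := by
  classical
  rw [PMF.bind_apply, tsum_eq_single a, pmf_map_apply_of_injective (Prod.mk_right_injective a)]
  intro a' ha'
  simp [PMF.map_apply, ha'.symm]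

theorem pmf_eq_of_forall_mem_support {p q : PMF α} (h : ∀ a ∈ p.support, p a = q a) : p = q := by
  have hle : ∀ a, p a ≤ q a := fun a => by
    by_cases ha : a ∈ p.support
    · exact (h a ha).le
    · rw [(p.apply_eq_zero_iff a).mpr ha]
      exact zero_le
  refine PMF.ext fun a => (hle a).antisymm (not_lt.mp fun hlt => ?_)
  have := ENNReal.tsum_lt_tsum p.tsum_coe_ne_top hle hlt
  rw [p.tsum_coe, q.tsum_coe] at this
  exact this.false

theorem pmf_sum_apply_eq_one [Fintype α] (p : PMF α) : ∑ a, p a = 1 := by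
  rw [← tsum_fintype (L := .unconditional _), p.tsum_coe]

theorem exists_pmf_lintegral_mul_eq {X : Type*} [MeasurableSpace X] [Finite α] [Nonempty α]
    {m : Measure X} {w : X → ENNReal} (hw : Measurable w) (hw_top : ∫⁻ x, w x ∂m ≠ ⊤)
    {p : X → PMF α} (hp : Measurable p) :
    ∃ q : PMF α, ∀ a, (∫⁻ x, w x ∂m) * q a = ∫⁻ x, w x * p x a ∂m := by
  have := Fintype.ofFinite α
  have hwp : ∀ a, Measurable fun x => w x * p x a := fun a =>
    hw.mul ((PMF.measurable_eval a).comp hp)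
  have hsum : ∑ a, ∫⁻ x, w x * p x a ∂m = ∫⁻ x, w x ∂m := by
    simp_rw [← lintegral_finsetSum _ fun a _ => hwp a, ← Finset.mul_sum, pmf_sum_apply_eq_one,
      mul_one]
  by_cases hw_zero : ∫⁻ x, w x ∂m = 0
  · rw [hw_zero, Finset.sum_eq_zero_iff] at hsum
    exact ⟨PMF.uniformOfFintype α, fun a => by rw [hw_zero, zero_mul, hsum a (Finset.mem_univ a)]⟩
  · refine ⟨PMF.ofFintype (fun a => (∫⁻ x, w x * p x a ∂m) / ∫⁻ x, w x ∂m) ?_, fun a => ?_⟩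
    · simp_rw [div_eq_mul_inv, ← Finset.sum_mul, hsum, ENNReal.mul_inv_cancel hw_zero hw_top]
    · exact ENNReal.mul_div_cancel hw_zero hw_top

theorem pmf_toMeasure_setOf_eq [MeasurableSpace α] [DiscreteMeasurableSpace α]
    (p : PMF α) (f : α → β) (b : β) : p.toMeasure {a | f a = b} = p.map f b := by
  rw [p.toMeasure_apply_eq_toOuterMeasure_apply .of_discrete, ← PMF.toOuterMeasure_apply_singleton,
    PMF.toOuterMeasure_map_apply]
  rfl

end ProbabilityMassFunctions

section FiniteProducts

variable {ι : Type u} [Fintype ι]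

theorem pmf_piFintype_map_eval [DecidableEq ι] {α : ι → Type v} [∀ i, Fintype (α i)]
    (p : ∀ i, PMF (α i)) (i : ι) : (PMF.piFintype p).map (fun a => a i) = p i := by
  classical
  refine PMF.ext fun b => ?_
  let fiber : ∀ j, Finset (α j) := Function.update (fun _ => Finset.univ) i {b}
  have mem_fiber (a : ∀ j, α j) : a ∈ Fintype.piFinset fiber ↔ b = a i := by
    rw [Fintype.mem_piFinset, Function.forall_update_iff _ (fun j t => a j ∈ t)]
    simp [eq_comm]
  calc (PMF.piFintype p).map (fun a => a i) b
      = ∑ a ∈ Fintype.piFinset fiber, ∏ j, p j (a j) := by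
        rw [PMF.map_apply, tsum_fintype, ← Finset.sum_filter]
        exact Finset.sum_congr (by ext a; simp [mem_fiber]) fun a _ => rfl
    _ = ∏ j, ∑ c ∈ fiber j, p j c := (Finset.prod_univ_sum fiber _).symm
    _ = p i b := by
        rw [Fintype.prod_eq_single i fun j hj => ?_]
        · simp [fiber]
        · simp [fiber, Function.update_of_ne hj, pmf_sum_apply_eq_one]

theorem lintegral_pi_prod {X : ι → Type*} [∀ i, MeasurableSpace (X i)]
    (m : ∀ i, Measure (X i)) [∀ i, IsProbabilityMeasure (m i)]
    {F : ∀ i, X i → ENNReal} (hF : ∀ i, Measurable (F i)) :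
    ∫⁻ x, ∏ i, F i (x i) ∂Measure.pi m = ∏ i, ∫⁻ y, F i y ∂m i := by
  rw [lintegral_prod_eq_prod_lintegral_of_indepFun Finset.univ (fun i (x : ∀ i, X i) => F i (x i))
    (iIndepFun_pi fun i => (hF i).aemeasurable) fun i => (hF i).comp (measurable_pi_apply i)]
  exact Finset.prod_congr rfl fun i _ => (measurePreserving_eval m i).lintegral_comp (hF i)

end FiniteProducts

theorem piCongr_trans_apply {α β γ : Type*} {X : α → Type*} {Y : β → Type*} {Z : γ → Type*}
    (e₁ : α ≃ β) (e₂ : β ≃ γ) (k₁ : ∀ a, X a ≃ Y (e₁ a)) (k₂ : ∀ b, Y b ≃ Z (e₂ b))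
    (x : ∀ a, X a) :
    (e₁.trans e₂).piCongr (fun a => (k₁ a).trans (k₂ (e₁ a))) x =
      e₂.piCongr k₂ (e₁.piCongr k₁ x) := by
  funext c
  obtain ⟨a, rfl⟩ := (e₁.trans e₂).surjective c
  calc (e₁.trans e₂).piCongr (fun a => (k₁ a).trans (k₂ (e₁ a))) x (e₂ (e₁ a))
      = k₂ (e₁ a) (k₁ a (x a)) := (e₁.trans e₂).piCongr_apply_apply _ x a
    _ = k₂ (e₁ a) (e₁.piCongr k₁ x (e₁ a)) := by rw [e₁.piCongr_apply_apply]
    _ = e₂.piCongr k₂ (e₁.piCongr k₁ x) (e₂ (e₁ a)) := (e₂.piCongr_apply_apply _ _ _).symm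

namespace DecPOMDP

variable {D : DecPOMDP.{u, v, w}} {i : D.Agent} {t : ℕ}

namespace Hist

/-- The action-observation history of agent `i` before its last action in `τ`. -/
def localHist (τ : D.Hist t) (i : D.Agent) : D.LocalHist i t :=
  fun k => (τ.2.1 k.castSucc i, τ.2.2 k i)

/-- The joint action at the last step. -/
def lastAction (τ : D.Hist t) : D.JointAction := τ.2.1 (Fin.last t)

/-- The state at the last step. -/
def lastState (τ : D.Hist t) : D.S := τ.1 (Fin.last t)

/-- The local history of agent `i` after its last action in `τ`, once the joint observation `o`
has been made. -/
def nextLocalHist (τ : D.Hist t) (o : D.JointObs) (i : D.Agent) : D.LocalHist i (t + 1) :=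
  fun k => (τ.2.1 k i, (Fin.snoc τ.2.2 o : Fin (t + 1) → D.JointObs) k i)

/-- The history consisting of one state and one joint action. -/
def single (s : D.S) (a : D.JointAction) : D.Hist 0 := (fun _ => s, fun _ => a, Fin.elim0)

/-- The extension of a history by one step. -/
def snoc (τ : D.Hist t) (s : D.S) (o : D.JointObs) (a : D.JointAction) : D.Hist (t + 1) :=
  (Fin.snoc τ.1 s, Fin.snoc τ.2.1 a, Fin.snoc τ.2.2 o)

/-- The restriction of a history to the steps up to `t`. -/
def truncate {n : ℕ} (h : t ≤ n) (τ : D.Hist n) : D.Hist t :=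
  (fun k => τ.1 (k.castLE (Nat.succ_le_succ h)), fun k => τ.2.1 (k.castLE (Nat.succ_le_succ h)),
    fun k => τ.2.2 (k.castLE h))

theorem localHist_snoc (τ : D.Hist t) (s : D.S) (o : D.JointObs) (a : D.JointAction) :
    (τ.snoc s o a).localHist i = τ.nextLocalHist o i := by
  funext k
  simp [localHist, snoc, nextLocalHist]

theorem lastAction_snoc (τ : D.Hist t) (s : D.S) (o : D.JointObs) (a : D.JointAction) :
    (τ.snoc s o a).lastAction = a := by
  simp [lastAction, snoc]

theorem init_nextLocalHist (τ : D.Hist t) (o : D.JointObs) :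
    Fin.init (τ.nextLocalHist o i) = τ.localHist i := by
  funext k
  simp [Fin.init, localHist, nextLocalHist]

theorem localHist_zero (τ : D.Hist 0) : τ.localHist i = Fin.elim0 := funext fun k => k.elim0

theorem exists_eq_single (τ : D.Hist 0) : ∃ s a, τ = single s a :=
  ⟨τ.1 0, τ.2.1 0, by ext k <;> first | exact k.elim0 | (rw [Fin.fin_one_eq_zero k]; rfl)⟩

theorem single_injective : Function.Injective fun x : D.S × D.JointAction => single x.1 x.2 :=
  fun _ _ h => Prod.ext (congrFun (congrArg Prod.fst h) 0) (congrFun (congrArg (·.2.1) h) 0)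

theorem exists_eq_snoc (τ : D.Hist (t + 1)) : ∃ τ' s o a, τ = snoc (t := t) τ' s o a :=
  ⟨(Fin.init τ.1, Fin.init τ.2.1, Fin.init τ.2.2), τ.1 (Fin.last _), τ.2.2 (Fin.last _),
    τ.2.1 (Fin.last _), by simp [snoc]⟩

theorem snoc_injective : Function.Injective
    fun x : D.Hist t × D.S × D.JointObs × D.JointAction => x.1.snoc x.2.1 x.2.2.1 x.2.2.2 := by
  rintro ⟨⟨_, _, _⟩, _, _, _⟩ ⟨⟨_, _, _⟩, _, _, _⟩ h
  simp_all [snoc, Fin.snoc_inj]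

theorem truncate_snoc {n : ℕ} (h : t ≤ n) (τ : D.Hist n) (s : D.S) (o : D.JointObs)
    (a : D.JointAction) :
    truncate (h.trans n.le_succ) (τ.snoc s o a) = truncate h τ := by
  refine Prod.ext ?_ (Prod.ext ?_ ?_) <;> funext k
  · exact Fin.snoc_castSucc (α := fun _ => D.S) _ _ (k.castLE (Nat.succ_le_succ h))
  · exact Fin.snoc_castSucc (α := fun _ => D.JointAction) _ _ (k.castLE (Nat.succ_le_succ h))
  · exact Fin.snoc_castSucc (α := fun _ => D.JointObs) _ _ (k.castLE h)

end Hist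

theorem histLaw_zero (π : D.Policy) : D.histLaw π 0 D.T.succ_pos =
    D.b₀.bind fun s => (PMF.piFintype fun i => π i 0 Fin.elim0).map (Hist.single s) :=
  rfl

theorem histLaw_succ (π : D.Policy) (ht : t + 1 < D.T + 1) :
    D.histLaw π (t + 1) ht = (D.histLaw π t (Nat.lt_of_succ_lt ht)).bind fun τ =>
      (D.trans τ.lastState τ.lastAction).bind fun s => (D.obs s τ.lastAction).bind fun o =>
        (PMF.piFintype fun i => π i ⟨t + 1, ht⟩ (τ.nextLocalHist o i)).map (τ.snoc s o) :=
  rfl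

theorem histLaw_zero_single_apply (π : D.Policy) (s : D.S) (a : D.JointAction) :
    D.histLaw π 0 D.T.succ_pos (Hist.single s a) = D.b₀ s * ∏ i, π i 0 Fin.elim0 (a i) := by
  have law_eq : D.histLaw π 0 D.T.succ_pos =
      (D.b₀.bind fun s => (PMF.piFintype fun i => π i 0 Fin.elim0).map (Prod.mk s)).map
        fun x => Hist.single x.1 x.2 := by
    simp only [histLaw_zero, PMF.map_bind, PMF.map_comp]
    rfl
  rw [law_eq, pmf_map_apply_of_injective Hist.single_injective (a := (s, a)),
    pmf_bind_map_prodMk_apply, PMF.piFintype, PMF.ofFintype_apply]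

theorem histLaw_succ_snoc_apply (π : D.Policy) (ht : t + 1 < D.T + 1) (τ : D.Hist t) (s : D.S)
    (o : D.JointObs) (a : D.JointAction) :
    D.histLaw π (t + 1) ht (τ.snoc s o a) = D.histLaw π t (Nat.lt_of_succ_lt ht) τ *
      (D.trans τ.lastState τ.lastAction s * (D.obs s τ.lastAction o *
        ∏ i, π i ⟨t + 1, ht⟩ (τ.nextLocalHist o i) (a i))) := by
  have law_eq : D.histLaw π (t + 1) ht =
      PMF.map (fun x : D.Hist t × D.S × D.JointObs × D.JointAction =>
          x.1.snoc x.2.1 x.2.2.1 x.2.2.2)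
        ((D.histLaw π t (Nat.lt_of_succ_lt ht)).bind fun τ =>
          ((D.trans τ.lastState τ.lastAction).bind fun s =>
            ((D.obs s τ.lastAction).bind fun o =>
              (PMF.piFintype fun i => π i ⟨t + 1, ht⟩ (τ.nextLocalHist o i)).map
                (Prod.mk o)).map (Prod.mk s)).map (Prod.mk τ)) := by
    simp only [histLaw_succ, PMF.map_bind, PMF.map_comp]
    rfl
  rw [law_eq, pmf_map_apply_of_injective Hist.snoc_injective (a := (τ, s, o, a)),
    pmf_bind_map_prodMk_apply, pmf_bind_map_prodMk_apply, pmf_bind_map_prodMk_apply,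
    PMF.piFintype, PMF.ofFintype_apply]

theorem histLaw_map_truncate (π : D.Policy) {n : ℕ} (h : t ≤ n) (hn : n < D.T + 1) :
    (D.histLaw π n hn).map (Hist.truncate h) = D.histLaw π t (h.trans_lt hn) := by
  induction n, h using Nat.le_induction with
  | base => exact PMF.map_id _
  | succ n h ih =>
    have truncate_comp_snoc (τ : D.Hist n) (s : D.S) (o : D.JointObs) :
        Hist.truncate (h.trans n.le_succ) ∘ τ.snoc s o = Function.const _ (τ.truncate h) :=
      funext fun a => τ.truncate_snoc h s o a
    rw [← ih (Nat.lt_of_succ_lt hn), histLaw_succ]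
    simp only [PMF.map_bind, PMF.map_comp, truncate_comp_snoc, PMF.map_const, PMF.bind_const]
    rfl

theorem histLaw_map_localHist_lastAction (π : D.Policy) (i : D.Agent) (ht : t < D.T + 1) :
    (D.histLaw π t ht).map (fun τ => (τ.localHist i, τ.lastAction i)) =
      ((D.histLaw π t ht).map fun τ => τ.localHist i).bind fun h =>
        (π i ⟨t, ht⟩ h).map (Prod.mk h) := by
  cases t with
  | zero =>
    have comp_single (s : D.S) :
        (fun τ : D.Hist 0 => (τ.localHist i, τ.lastAction i)) ∘ Hist.single s =
          Prod.mk Fin.elim0 ∘ fun a => a i :=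
      funext fun a => Prod.ext (Hist.localHist_zero _) rfl
    have localHist_comp_single (s : D.S) :
        (fun τ : D.Hist 0 => τ.localHist i) ∘ Hist.single s = Function.const _ Fin.elim0 :=
      funext fun a => Hist.localHist_zero _
    simp only [histLaw_zero, PMF.map_bind, PMF.map_comp, comp_single, localHist_comp_single,
      PMF.map_const, PMF.bind_const, PMF.pure_bind]
    simp only [← PMF.map_comp, pmf_piFintype_map_eval]
    rfl
  | succ t =>
    have comp_snoc (τ : D.Hist t) (s : D.S) (o : D.JointObs) :
        (fun τ => (τ.localHist i, τ.lastAction i)) ∘ τ.snoc s o =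
          Prod.mk (τ.nextLocalHist o i) ∘ fun a => a i :=
      funext fun a => Prod.ext (τ.localHist_snoc s o a) (congrFun (τ.lastAction_snoc s o a) i)
    have localHist_comp_snoc (τ : D.Hist t) (s : D.S) (o : D.JointObs) :
        (fun τ => τ.localHist i) ∘ τ.snoc s o = Function.const _ (τ.nextLocalHist o i) :=
      funext fun a => τ.localHist_snoc s o a
    simp only [histLaw_succ, PMF.map_bind, PMF.map_comp, comp_snoc, localHist_comp_snoc,
      PMF.map_const, PMF.bind_bind, PMF.pure_bind]
    simp only [← PMF.map_comp, pmf_piFintype_map_eval]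

/-- The factor which the environment contributes to the probability of a history. -/
noncomputable def Hist.envWeight (τ : D.Hist t) : ENNReal :=
  D.b₀ (τ.1 0) * ∏ k : Fin t, D.trans (τ.1 k.castSucc) (τ.2.1 k.castSucc) (τ.1 k.succ) *
    D.obs (τ.1 k.succ) (τ.2.1 k.castSucc) (τ.2.2 k)

/-- The factor which the local policy of an agent contributes to the probability of its local
history: the product of the probabilities with which the policy selects the actions in `h`. -/
noncomputable def reachWeight (σ : D.LocalPolicy i) :
    (t : ℕ) → t < D.T + 1 → D.LocalHist i t → ENNReal
  | 0, _, _ => 1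
  | t + 1, ht, h =>
    reachWeight σ t (Nat.lt_of_succ_lt ht) (Fin.init h) *
      σ ⟨t, Nat.lt_of_succ_lt ht⟩ (Fin.init h) (h (Fin.last t)).1

theorem measurable_localPolicy_apply (t : Fin (D.T + 1)) (h : D.LocalHist i t) :
    Measurable fun σ : D.LocalPolicy i => σ t h :=
  (measurable_pi_apply h).comp (measurable_pi_apply t)

theorem measurable_reachWeight (ht : t < D.T + 1) (h : D.LocalHist i t) :
    Measurable fun σ : D.LocalPolicy i => reachWeight σ t ht h := by
  induction t with
  | zero => exact measurable_const
  | succ t ih =>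
    exact (ih _ _).mul ((PMF.measurable_eval _).comp (measurable_localPolicy_apply _ _))

theorem measurable_reachWeight_mul_apply (t : Fin (D.T + 1)) (h : D.LocalHist i t) (a : D.A i) :
    Measurable fun σ : D.LocalPolicy i => reachWeight σ t t.2 h * σ t h a :=
  (measurable_reachWeight t.2 h).mul
    ((PMF.measurable_eval a).comp (measurable_localPolicy_apply t h))

theorem reachWeight_le_one (σ : D.LocalPolicy i) (ht : t < D.T + 1) (h : D.LocalHist i t) :
    reachWeight σ t ht h ≤ 1 := by
  induction t with
  | zero => exact le_rfl
  | succ t ih => exact mul_le_one' (ih _ _) (PMF.coe_le_one _ _)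

theorem Hist.envWeight_snoc (τ : D.Hist t) (s : D.S) (o : D.JointObs) (a : D.JointAction) :
    (τ.snoc s o a).envWeight =
      τ.envWeight * (D.trans τ.lastState τ.lastAction s * D.obs s τ.lastAction o) := by
  simp only [envWeight, snoc, lastState, lastAction, Fin.prod_univ_castSucc (n := t),
    Fin.succ_castSucc, Fin.succ_last, Fin.snoc_castSucc, Fin.snoc_last, ← Fin.castSucc_zero,
    mul_assoc]

theorem reachWeight_nextLocalHist (σ : D.LocalPolicy i) (ht : t + 1 < D.T + 1) (τ : D.Hist t)
    (o : D.JointObs) :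
    reachWeight σ (t + 1) ht (τ.nextLocalHist o i) =
      reachWeight σ t (Nat.lt_of_succ_lt ht) (τ.localHist i) *
        σ ⟨t, Nat.lt_of_succ_lt ht⟩ (τ.localHist i) (τ.lastAction i) := by
  rw [reachWeight, τ.init_nextLocalHist o]
  rfl

theorem histLaw_apply (π : D.Policy) (ht : t < D.T + 1) (τ : D.Hist t) :
    D.histLaw π t ht τ = τ.envWeight * ∏ i,
      (reachWeight (π i) t ht (τ.localHist i) * π i ⟨t, ht⟩ (τ.localHist i) (τ.lastAction i)) := by
  induction t with
  | zero =>
    obtain ⟨s, a, rfl⟩ := τ.exists_eq_single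
    rw [histLaw_zero_single_apply]
    simp [Hist.envWeight, reachWeight, Hist.localHist_zero, Hist.single,
      Hist.lastAction]
  | succ t ih =>
    obtain ⟨τ, s, o, a, rfl⟩ := τ.exists_eq_snoc
    simp only [histLaw_succ_snoc_apply, ih, Hist.envWeight_snoc, Hist.localHist_snoc,
      Hist.lastAction_snoc, reachWeight_nextLocalHist, Finset.prod_mul_distrib]
    ring

instance : DiscreteMeasurableSpace D.History := ⟨fun _ => trivial⟩

/-- The law of the local history `H_{i,t}` under the joint policy `π`. -/
noncomputable def localHistLaw (π : D.Policy) (i : D.Agent) (t : Fin (D.T + 1)) :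
    PMF (D.LocalHist i t) :=
  (D.law π).map fun τ => τ.localHist i t

theorem localHistLaw_eq_map_histLaw (π : D.Policy) (i : D.Agent) (t : Fin (D.T + 1)) :
    localHistLaw π i t = (D.histLaw π t t.2).map fun τ => τ.localHist i := by
  rw [← histLaw_map_truncate π (Nat.le_of_lt_succ t.2) D.T.lt_succ_self, PMF.map_comp]
  rfl

theorem law_map_localHist_action (π : D.Policy) (i : D.Agent) (t : Fin (D.T + 1)) :
    (D.law π).map (fun τ => (τ.localHist i t, τ.action t i)) =
      (localHistLaw π i t).bind fun h => (π i t h).map (Prod.mk h) := by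
  rw [localHistLaw_eq_map_histLaw, ← histLaw_map_localHist_lastAction,
    ← histLaw_map_truncate π (Nat.le_of_lt_succ t.2) D.T.lt_succ_self, PMF.map_comp]
  rfl

/-- `ρ` is realization equivalent to the mixed local policy `m`: both select every sequence of
actions with the same probability, given the observations in between. -/
def RealizationEquiv (m : ProbabilityMeasure (D.LocalPolicy i)) (ρ : D.LocalPolicy i) : Prop :=
  ∀ (t : Fin (D.T + 1)) (h : D.LocalHist i t) (a : D.A i),
    reachWeight ρ t t.2 h * ρ t h a = ∫⁻ σ, reachWeight σ t t.2 h * σ t h a ∂m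

theorem exists_realizationEquiv (m : ProbabilityMeasure (D.LocalPolicy i)) :
    ∃ ρ, RealizationEquiv m ρ := by
  have := nonempty_action i m
  have reach_ne_top (t : Fin (D.T + 1)) (h : D.LocalHist i t) :
      ∫⁻ σ, reachWeight σ t t.2 h ∂m ≠ ⊤ :=
    ((lintegral_mono fun σ => reachWeight_le_one σ t.2 h).trans_lt (by simp)).ne
  choose ρ hρ using fun (t : Fin (D.T + 1)) (h : D.LocalHist i t) =>
    exists_pmf_lintegral_mul_eq (measurable_reachWeight t.2 h) (reach_ne_top t h)
      (measurable_localPolicy_apply t h)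
  have reach_eq (t : ℕ) (ht : t < D.T + 1) (h : D.LocalHist i t) :
      reachWeight ρ t ht h = ∫⁻ σ, reachWeight σ t ht h ∂m := by
    induction t with
    | zero => simp [reachWeight]
    | succ t ih => simpa only [reachWeight, ih] using hρ ⟨t, Nat.lt_of_succ_lt ht⟩ _ _
  exact ⟨ρ, fun t h a => by rw [reach_eq, hρ]⟩

theorem realizationEquiv_dirac (σ : D.LocalPolicy i) :
    RealizationEquiv ⟨Measure.dirac σ, Measure.dirac.isProbabilityMeasure⟩ σ := fun t h a =>
  (lintegral_dirac' σ (measurable_reachWeight_mul_apply t h a)).symm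

section Kuhn

variable {μ : ProbabilityMeasure D.Policy} {m : ∀ i, ProbabilityMeasure (D.LocalPolicy i)}
  {ρ : D.Policy}

/-- Kuhn's theorem: the weights of a history factorize over the agents, so an expectation over
independent local policies can be taken agent by agent. -/
theorem lintegral_histLaw_eq_histLaw
    (hμ : (μ : Measure D.Policy) = Measure.pi fun i => (m i : Measure (D.LocalPolicy i)))
    (hρ : ∀ i, RealizationEquiv (m i) (ρ i)) (t : Fin (D.T + 1)) (τ : D.Hist t) :
    ∫⁻ π, D.histLaw π t t.2 τ ∂μ = D.histLaw ρ t t.2 τ := by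
  let weight (j : D.Agent) (σ : D.LocalPolicy j) : ENNReal :=
    reachWeight σ t t.2 (τ.localHist j) * σ t (τ.localHist j) (τ.lastAction j)
  have measurable_weight (j : D.Agent) : Measurable (weight j) :=
    measurable_reachWeight_mul_apply t _ _
  have measurable_prod_weight : Measurable fun π : D.Policy => ∏ j, weight j (π j) :=
    Finset.measurable_prod _ fun j _ => (measurable_weight j).comp (measurable_pi_apply j)
  calc ∫⁻ π, D.histLaw π t t.2 τ ∂μ
      = ∫⁻ π : D.Policy, τ.envWeight * ∏ j, weight j (π j)
          ∂Measure.pi fun j => (m j : Measure (D.LocalPolicy j)) := by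
        simp only [histLaw_apply, hμ, weight]
    _ = τ.envWeight * ∏ j, ∫⁻ σ, weight j σ ∂m j := by
        rw [lintegral_const_mul _ measurable_prod_weight, lintegral_pi_prod _ measurable_weight]
    _ = D.histLaw ρ t t.2 τ := by
        rw [histLaw_apply]
        exact congrArg _ (Finset.prod_congr rfl fun j _ => (hρ j t _ _).symm)

theorem snd_mixLaw_eq (hμ : (μ : Measure D.Policy) = Measure.pi fun i => (m i : Measure _))
    (hρ : ∀ i, RealizationEquiv (m i) (ρ i)) :
    (D.mixLaw μ).snd = (D.law ρ).toMeasure := by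
  refine Measure.ext_of_singleton fun τ => ?_
  rw [mixLaw, Measure.snd_compProd, Measure.bind_apply .of_discrete D.episodeKernel.aemeasurable,
    PMF.toMeasure_apply_singleton _ _ .of_discrete]
  calc ∫⁻ π, D.episodeKernel π {τ} ∂μ
      = ∫⁻ π, D.law π τ ∂μ :=
        lintegral_congr fun π => PMF.toMeasure_apply_singleton _ _ .of_discrete
    _ = D.law ρ τ := lintegral_histLaw_eq_histLaw hμ hρ (Fin.last D.T) τ

end Kuhn

section Conditioning

variable {μ : ProbabilityMeasure D.Policy} {π : D.Policy} {t : Fin (D.T + 1)}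

theorem integral_J_eq_J (hμ : (D.mixLaw μ).snd = (D.law π).toMeasure) :
    ∫ π', D.J π' ∂μ = D.J π := by
  have hsnd : AEMeasurable Prod.snd (D.mixLaw μ) := measurable_snd.aemeasurable
  have hreward (ν : Measure D.History) :
      AEStronglyMeasurable (History.totalReward (D := D)) ν :=
    Measurable.of_discrete.aestronglyMeasurable
  have hint : Integrable (fun x : D.Policy × D.History => x.2.totalReward) (D.mixLaw μ) :=
    (integrable_map_measure (hreward _) hsnd).mp .of_finite
  calc ∫ π', D.J π' ∂μ
      = ∫ x, x.2.totalReward ∂D.mixLaw μ := (Measure.integral_compProd hint).symm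
    _ = ∫ τ, τ.totalReward ∂(D.mixLaw μ).snd := (integral_map hsnd (hreward _)).symm
    _ = D.J π := by rw [hμ, J]

theorem mixLaw_histEvent (hμ : (D.mixLaw μ).snd = (D.law π).toMeasure) (h : D.LocalHist i t) :
    D.mixLaw μ (histEvent i t h) = localHistLaw π i t h := by
  rw [localHistLaw, ← pmf_toMeasure_setOf_eq, ← hμ, Measure.snd_apply .of_discrete]
  rfl

theorem cond_actionEvent_histEvent (hμ : (D.mixLaw μ).snd = (D.law π).toMeasure)
    {h : D.LocalHist i t} (hh : h ∈ (localHistLaw π i t).support) (a : D.A i) :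
    (D.mixLaw μ)[actionEvent i t a | histEvent i t h] = π i t h a := by
  have hist_inter_action :
      D.mixLaw μ (histEvent i t h ∩ actionEvent i t a) = localHistLaw π i t h * π i t h a := by
    rw [← pmf_bind_map_prodMk_apply, ← law_map_localHist_action,
      ← pmf_toMeasure_setOf_eq, ← hμ, Measure.snd_apply .of_discrete]
    simp only [Prod.mk.injEq]
    rfl
  have measurableSet_histEvent : MeasurableSet (histEvent i t h) :=
    measurable_snd (MeasurableSet.of_discrete (s := {τ : D.History | τ.localHist i t = h}))
  rw [cond_apply measurableSet_histEvent, hist_inter_action, mixLaw_histEvent hμ,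
    ENNReal.inv_mul_cancel_left ((PMF.mem_support_iff _ _).mp hh) (PMF.apply_ne_top _ _)]

end Conditioning

section WellDefined

variable {m : ProbabilityMeasure (D.LocalPolicy i)} {ρ : D.LocalPolicy i} {t : Fin (D.T + 1)}
  {h : D.LocalHist i t}

theorem snd_mixLaw_withOpponents_eq {π : D.Policy} (hρ : RealizationEquiv m (π i))
    {ν : ∀ j, ProbabilityMeasure (D.LocalPolicy j)}
    (hν : ∀ j ≠ i, RealizationEquiv (ν j) (π j)) :
    (D.mixLaw (withOpponents i m ν)).snd = (D.law π).toMeasure := by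
  refine snd_mixLaw_eq rfl fun j => ?_
  obtain rfl | hj := eq_or_ne j i
  · rwa [Function.update_self]
  · rw [Function.update_of_ne hj]
    exact hν j hj

theorem exists_snd_mixLaw_withOpponents_eq (hρ : RealizationEquiv m ρ)
    (ν : ∀ j, ProbabilityMeasure (D.LocalPolicy j)) :
    ∃ π : D.Policy, π i = ρ ∧ (D.mixLaw (withOpponents i m ν)).snd = (D.law π).toMeasure := by
  choose ρ' hρ' using fun j => exists_realizationEquiv (ν j)
  refine ⟨Function.update ρ' i ρ, Function.update_self _ _ _,
    snd_mixLaw_withOpponents_eq (by rwa [Function.update_self]) fun j hj => ?_⟩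
  rw [Function.update_of_ne hj]
  exact hρ' j

/-- The local history `h` has positive probability when agent `i` plays `ρ` against suitable
opponents. -/
def Attainable (ρ : D.LocalPolicy i) (t : Fin (D.T + 1)) (h : D.LocalHist i t) : Prop :=
  ∃ π : D.Policy, π i = ρ ∧ h ∈ (localHistLaw π i t).support

theorem exists_mixLaw_histEvent_ne_zero_iff (hρ : RealizationEquiv m ρ) :
    (∃ ν, D.mixLaw (withOpponents i m ν) (histEvent i t h) ≠ 0) ↔ Attainable ρ t h := by
  constructor
  · rintro ⟨ν, hν⟩
    obtain ⟨π, hπ, hmix⟩ := exists_snd_mixLaw_withOpponents_eq hρ ν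
    exact ⟨π, hπ, (PMF.mem_support_iff _ _).mpr (mixLaw_histEvent hmix h ▸ hν)⟩
  · rintro ⟨π, rfl, hh⟩
    have hmix := snd_mixLaw_withOpponents_eq hρ fun j _ => realizationEquiv_dirac (π j)
    exact ⟨_, mixLaw_histEvent hmix h ▸
      (PMF.mem_support_iff _ _).mp hh⟩

theorem cond_withOpponents_eq (hρ : RealizationEquiv m ρ)
    {ν : ∀ j, ProbabilityMeasure (D.LocalPolicy j)}
    (hν : D.mixLaw (withOpponents i m ν) (histEvent i t h) ≠ 0) (a : D.A i) :
    (D.mixLaw (withOpponents i m ν))[actionEvent i t a | histEvent i t h] = ρ t h a := by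
  obtain ⟨π, rfl, hmix⟩ := exists_snd_mixLaw_withOpponents_eq hρ ν
  exact cond_actionEvent_histEvent hmix
    ((PMF.mem_support_iff _ _).mpr (mixLaw_histEvent hmix h ▸ hν)) a

theorem behaviourLocal_of_attainable (hρ : RealizationEquiv m ρ) (hh : Attainable ρ t h) :
    behaviourLocal i m t h = ρ t h := by
  have hex := (exists_mixLaw_histEvent_ne_zero_iff hρ).mpr hh
  refine PMF.ext fun a => ?_
  rw [behaviourLocal, dif_pos hex, PMF.ofFintype_apply]
  exact cond_withOpponents_eq hρ hex.choose_spec a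

theorem behaviourLocal_apply_of_not_attainable (hρ : RealizationEquiv m ρ)
    (hh : ¬ Attainable ρ t h) (a : D.A i) :
    behaviourLocal i m t h a = (Fintype.card (D.A i) : ENNReal)⁻¹ := by
  have := nonempty_action i m
  rw [behaviourLocal, dif_neg (mt (exists_mixLaw_histEvent_ne_zero_iff hρ).mp hh),
    PMF.uniformOfFintype_apply]

theorem corresponds_behaviour (μ : ProbabilityMeasure D.Policy) :
    Corresponds μ (behaviour μ) := by
  intro i t h
  obtain ⟨ρ, hρ⟩ := exists_realizationEquiv (marginal μ i)
  refine ⟨fun ν hν a => ?_, fun hzero a => ?_⟩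
  · rw [cond_withOpponents_eq hρ hν, behaviour, behaviourLocal_of_attainable hρ]
    exact (exists_mixLaw_histEvent_ne_zero_iff hρ).mp ⟨ν, hν⟩
  · refine behaviourLocal_apply_of_not_attainable hρ (fun hh => ?_) a
    obtain ⟨ν, hν⟩ := (exists_mixLaw_histEvent_ne_zero_iff hρ).mpr hh
    exact hν (hzero ν)

end WellDefined

theorem histLaw_congr {π ρ : D.Policy}
    (hπ : ∀ i t, ∀ h ∈ (localHistLaw ρ i t).support, π i t h = ρ i t h) {t : ℕ}
    (ht : t < D.T + 1) : D.histLaw π t ht = D.histLaw ρ t ht := by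
  have apply_localHist (t : Fin (D.T + 1)) (τ : D.Hist t)
      (hτ : τ ∈ (D.histLaw ρ t t.2).support) (i : D.Agent) :
      π i t (τ.localHist i) = ρ i t (τ.localHist i) := by
    refine hπ i t _ ?_
    rw [localHistLaw_eq_map_histLaw]
    exact (PMF.mem_support_map_iff _ _ _).mpr ⟨τ, hτ, rfl⟩
  refine (pmf_eq_of_forall_mem_support fun τ hτ => ?_).symm
  induction t with
  | zero =>
    have hlocal (i : D.Agent) : π i 0 Fin.elim0 = ρ i 0 Fin.elim0 :=
      τ.localHist_zero (i := i) ▸ apply_localHist ⟨0, ht⟩ τ hτ i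
    obtain ⟨s, a, rfl⟩ := τ.exists_eq_single
    simp only [histLaw_zero_single_apply, hlocal]
  | succ t ih =>
    have hlocal := apply_localHist ⟨t + 1, ht⟩ τ hτ
    obtain ⟨τ, s, o, a, rfl⟩ := τ.exists_eq_snoc
    rw [PMF.mem_support_iff, histLaw_succ_snoc_apply] at hτ
    have hprefix := ih (Nat.lt_of_succ_lt ht) τ
      ((PMF.mem_support_iff _ _).mpr (left_ne_zero_of_mul hτ))
    simp only [Hist.localHist_snoc] at hlocal
    simp only [histLaw_succ_snoc_apply, hprefix, hlocal]

theorem integral_J_eq_J_behaviour {μ : ProbabilityMeasure D.Policy}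
    (hμ : (μ : Measure D.Policy) = Measure.pi fun i => (marginal μ i : Measure _)) :
    ∫ π, D.J π ∂μ = D.J (behaviour μ) := by
  choose ρ hρ using fun i => exists_realizationEquiv (marginal μ i)
  have law_behaviour : D.law (behaviour μ) = D.law ρ :=
    histLaw_congr (fun i t h hh => behaviourLocal_of_attainable (hρ i) ⟨ρ, rfl, hh⟩) _
  exact integral_J_eq_J (law_behaviour ▸ snd_mixLaw_eq hμ hρ)

section OtherPlay

/-- The local policy of agent `i` under the other-play distribution: its local policy in `f^*π`
for a uniformly distributed automorphism `f`. -/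
noncomputable def opLocal (π : D.Policy) (i : D.Agent) : ProbabilityMeasure (D.LocalPolicy i) :=
  ⟨(Fintype.card D.Aut : ENNReal)⁻¹ • ∑ f : D.Aut, Measure.dirac (f.push π i), ⟨by
    simp [ENNReal.inv_mul_cancel]⟩⟩

theorem opDist_eq_pi (π : D.Policy) :
    (opDist π : Measure D.Policy) = Measure.pi fun i => (opLocal π i : Measure _) := by
  refine (Measure.pi_eq fun s hs => ?_).symm
  have dirac_profile (g : D.Agent → D.Aut) :
      Measure.dirac (pushProfile g π) (Set.univ.pi s) =
        ∏ i, Measure.dirac ((g i).push π i) (s i) := by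
    classical
    simp [Measure.dirac_apply', MeasurableSet.univ_pi hs, hs, Set.indicator_apply,
      Finset.prod_ite_zero, pushProfile]
  simp only [opDist, opLocal, ProbabilityMeasure.coe_mk, Measure.smul_apply,
    Measure.finsetSum_apply, smul_eq_mul, dirac_profile, Finset.prod_mul_distrib,
    Finset.prod_const, Finset.card_univ, Fintype.card_fin, Fintype.prod_sum, ENNReal.inv_pow]

theorem marginal_opDist (π : D.Policy) (i : D.Agent) : marginal (opDist π) i = opLocal π i := by
  refine ProbabilityMeasure.toMeasure_injective ?_
  rw [marginal, ProbabilityMeasure.toMeasure_map, opDist_eq_pi]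
  exact (measurePreserving_eval (fun i => (opLocal π i : Measure (D.LocalPolicy i))) i).map_eq

theorem stronglyMeasurable_J : StronglyMeasurable D.J :=
  StronglyMeasurable.integral_kernel (κ := D.episodeKernel)
    (Measurable.of_discrete (f := History.totalReward (D := D))).stronglyMeasurable

theorem JOP_eq_integral (π : D.Policy) : D.JOP π = ∫ π', D.J π' ∂opDist π := by
  have integrable_dirac (g : D.Agent → D.Aut) :
      Integrable D.J (Measure.dirac (pushProfile g π)) :=
    integrable_dirac' stronglyMeasurable_J (by simp)
  simp only [opDist, ProbabilityMeasure.coe_mk, integral_smul_measure,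
    integral_finsetSum_measure fun g _ => integrable_dirac g,
    integral_dirac' _ _ stronglyMeasurable_J]
  simp [JOP, div_eq_inv_mul]

theorem JOP_eq_J_symmetrizer (π : D.Policy) : D.JOP π = D.J (symmetrizer π) := by
  rw [JOP_eq_integral, symmetrizer, integral_J_eq_J_behaviour]
  simp only [marginal_opDist, opDist_eq_pi]

theorem JOP_eq_J_of_isInvariant {π : D.Policy} (hπ : IsInvariant π) : D.JOP π = D.J π := by
  have pushProfile_eq (g : D.Agent → D.Aut) : pushProfile g π = π :=
    funext fun i => congrFun (hπ (g i)) i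
  simp_rw [JOP, pushProfile_eq, Finset.sum_const, nsmul_eq_mul, Finset.card_univ]
  exact mul_div_cancel_left₀ _ (Nat.cast_ne_zero.mpr Fintype.card_ne_zero)

end OtherPlay

namespace Aut

/-- The composition of automorphisms. -/
def comp (f g : D.Aut) : D.Aut where
  onAgent := g.onAgent.trans f.onAgent
  onState := g.onState.trans f.onState
  onAction i := (g.onAction i).trans (f.onAction (g.onAgent i))
  onObs i := (g.onObs i).trans (f.onObs (g.onAgent i))
  trans_eq s s' a := by
    rw [g.trans_eq, f.trans_eq, piCongr_trans_apply]
    rfl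
  obs_eq s a o := by
    rw [g.obs_eq, f.obs_eq, piCongr_trans_apply, piCongr_trans_apply]
    rfl
  reward_eq s a := by
    rw [g.reward_eq, f.reward_eq, piCongr_trans_apply]
    rfl
  b₀_eq s := by
    rw [g.b₀_eq, f.b₀_eq]
    rfl

theorem comp_injective (f : D.Aut) : Function.Injective f.comp := by
  rintro ⟨onAgent, onState, onAction, onObs, _, _, _, _⟩
    ⟨onAgent', onState', onAction', onObs', _, _, _, _⟩ h
  simp only [comp, mk.injEq] at h
  obtain ⟨hagent, hstate, haction, hobs⟩ := h
  obtain rfl : onAgent = onAgent' :=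
    Equiv.ext fun i => f.onAgent.injective (DFunLike.congr_fun hagent i)
  obtain rfl : onState = onState' :=
    Equiv.ext fun s => f.onState.injective (DFunLike.congr_fun hstate s)
  obtain rfl : onAction = onAction' := funext fun i => Equiv.ext fun a =>
    (f.onAction _).injective (DFunLike.congr_fun (congrFun (eq_of_heq haction) i) a)
  obtain rfl : onObs = onObs' := funext fun i => Equiv.ext fun o =>
    (f.onObs _).injective (DFunLike.congr_fun (congrFun (eq_of_heq hobs) i) o)
  rfl

theorem comp_bijective (f : D.Aut) : Function.Bijective f.comp :=
  Finite.injective_iff_bijective.mp f.comp_injective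

/-- The elementwise action of an automorphism on local histories. -/
def onLocalHist (f : D.Aut) (i : D.Agent) (t : ℕ) :
    D.LocalHist i t ≃ D.LocalHist (f.onAgent i) t :=
  Equiv.arrowCongr (Equiv.refl _) ((f.onAction i).prodCongr (f.onObs i))

/-- The elementwise action of an automorphism on histories. -/
def onHist (f : D.Aut) (t : ℕ) : D.Hist t ≃ D.Hist t :=
  (Equiv.arrowCongr (Equiv.refl _) f.onState).prodCongr
    ((Equiv.arrowCongr (Equiv.refl _) (f.onAgent.piCongr f.onAction)).prodCongr
      (Equiv.arrowCongr (Equiv.refl _) (f.onAgent.piCongr f.onObs)))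

theorem localHist_onHist (f : D.Aut) (τ : D.Hist t) (i : D.Agent) :
    (f.onHist t τ).localHist (f.onAgent i) = f.onLocalHist i t (τ.localHist i) :=
  funext fun _ => Prod.ext (f.onAgent.piCongr_apply_apply f.onAction _ i)
    (f.onAgent.piCongr_apply_apply f.onObs _ i)

theorem lastAction_onHist (f : D.Aut) (τ : D.Hist t) (i : D.Agent) :
    (f.onHist t τ).lastAction (f.onAgent i) = f.onAction i (τ.lastAction i) :=
  f.onAgent.piCongr_apply_apply f.onAction _ i

theorem envWeight_onHist (f : D.Aut) (τ : D.Hist t) :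
    (f.onHist t τ).envWeight = τ.envWeight := by
  simp only [Hist.envWeight, f.b₀_eq (τ.1 0), f.trans_eq (τ.1 _), f.obs_eq (τ.1 _)]
  rfl

variable (f : D.Aut)

theorem pushLocal_apply (σ : D.LocalPolicy i) (t : Fin (D.T + 1)) (h : D.LocalHist i t)
    (a : D.A i) :
    f.pushLocal i σ t (f.onLocalHist i t h) (f.onAction i a) = σ t h a := by
  rw [pushLocal, pmf_map_apply_of_injective (f.onAction i).injective]
  simp [onLocalHist]

theorem pushLocal_eq_of_forall {σ : D.LocalPolicy i} {ρ : D.LocalPolicy (f.onAgent i)}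
    (hρ : ∀ t h a, ρ t (f.onLocalHist i t h) (f.onAction i a) = σ t h a) :
    f.pushLocal i σ = ρ := by
  refine funext fun t => funext ((f.onLocalHist i t).surjective.forall.mpr fun h => ?_)
  refine PMF.ext ((f.onAction i).surjective.forall.mpr fun a => ?_)
  rw [hρ, pushLocal_apply]

theorem pushLocal_bijective (i : D.Agent) : Function.Bijective (f.pushLocal i) := by
  constructor
  · intro σ σ' hσ
    refine funext fun t => funext fun h => PMF.ext fun a => ?_
    rw [← f.pushLocal_apply σ, hσ, pushLocal_apply]
  · intro ρ
    refine ⟨fun t h => (ρ t (f.onLocalHist i t h)).map (f.onAction i).symm,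
      f.pushLocal_eq_of_forall fun t h a => ?_⟩
    rw [← pmf_map_apply_of_injective (f.onAction i).symm.injective, Equiv.symm_apply_apply]

theorem measurable_pushLocal (i : D.Agent) : Measurable (f.pushLocal i) := by
  refine measurable_pi_lambda _ fun t => measurable_pi_lambda _ fun h =>
    measurable_comap_iff.mpr (measurable_pi_lambda _ fun a => ?_)
  obtain ⟨h, rfl⟩ := (f.onLocalHist i t).surjective h
  obtain ⟨a, rfl⟩ := (f.onAction i).surjective a
  simpa only [Function.comp_def, pushLocal_apply] using
    (PMF.measurable_eval a).comp (measurable_localPolicy_apply t h)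

theorem comp_pushLocal (g : D.Aut) (σ : D.LocalPolicy i) :
    (f.comp g).pushLocal i σ = f.pushLocal (g.onAgent i) (g.pushLocal i σ) :=
  (f.comp g).pushLocal_eq_of_forall fun t h a => by
    rw [← g.pushLocal_apply σ t h a, ← f.pushLocal_apply (g.pushLocal i σ)]
    rfl

theorem reachWeight_pushLocal (σ : D.LocalPolicy i) (ht : t < D.T + 1) (h : D.LocalHist i t) :
    reachWeight (f.pushLocal i σ) t ht (f.onLocalHist i t h) = reachWeight σ t ht h := by
  induction t with
  | zero => rfl
  | succ t ih =>
    have init_onLocalHist :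
        Fin.init (f.onLocalHist i (t + 1) h) = f.onLocalHist i t (Fin.init h) :=
      rfl
    rw [reachWeight, init_onLocalHist, ih]
    exact congrArg _ (f.pushLocal_apply σ ⟨t, _⟩ (Fin.init h) (h (Fin.last t)).1)

theorem push_apply_onAgent (π : D.Policy) (i : D.Agent) :
    f.push π (f.onAgent i) = f.pushLocal i (π i) :=
  Equiv.piCongrLeft_apply_apply _ _ _ _

theorem push_surjective : Function.Surjective f.push := fun π => by
  choose ρ hρ using fun i => (f.pushLocal_bijective i).surjective (π (f.onAgent i))
  refine ⟨ρ, funext (f.onAgent.surjective.forall.mpr fun i => ?_)⟩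
  rw [push_apply_onAgent, hρ]

theorem comp_push (g : D.Aut) (π : D.Policy) : (f.comp g).push π = f.push (g.push π) :=
  funext ((f.comp g).onAgent.surjective.forall.mpr fun i => by
    rw [push_apply_onAgent, comp_pushLocal, ← push_apply_onAgent, ← push_apply_onAgent]
    rfl)

theorem histLaw_push_onHist (π : D.Policy) (ht : t < D.T + 1) (τ : D.Hist t) :
    D.histLaw (f.push π) t ht (f.onHist t τ) = D.histLaw π t ht τ := by
  rw [histLaw_apply, histLaw_apply, envWeight_onHist, ← f.onAgent.prod_comp]
  refine congrArg _ (Finset.prod_congr rfl fun i _ => ?_)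
  rw [localHist_onHist, lastAction_onHist, push_apply_onAgent, reachWeight_pushLocal]
  exact congrArg _ (f.pushLocal_apply (π i) ⟨t, ht⟩ (τ.localHist i) (τ.lastAction i))

theorem histLaw_push (π : D.Policy) (ht : t < D.T + 1) :
    D.histLaw (f.push π) t ht = (D.histLaw π t ht).map (f.onHist t) :=
  PMF.ext ((f.onHist t).surjective.forall.mpr fun τ => by
    rw [histLaw_push_onHist, pmf_map_apply_of_injective (f.onHist t).injective])

theorem localHistLaw_push (π : D.Policy) (i : D.Agent) (t : Fin (D.T + 1)) :
    localHistLaw (f.push π) (f.onAgent i) t = (localHistLaw π i t).map (f.onLocalHist i t) := by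
  simp only [localHistLaw_eq_map_histLaw, histLaw_push, PMF.map_comp]
  exact congrArg (PMF.map · _) (funext fun τ => f.localHist_onHist τ i)

theorem attainable_pushLocal_iff {ρ : D.LocalPolicy i} {t : Fin (D.T + 1)}
    {h : D.LocalHist i t} :
    Attainable (f.pushLocal i ρ) t (f.onLocalHist i t h) ↔ Attainable ρ t h := by
  rw [Attainable, f.push_surjective.exists]
  simp only [Attainable, push_apply_onAgent, (f.pushLocal_bijective i).injective.eq_iff,
    PMF.mem_support_iff, localHistLaw_push,
    pmf_map_apply_of_injective (f.onLocalHist i t).injective]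

/-- The image of a mixed local policy under the action of an automorphism. -/
noncomputable def pushMixed (i : D.Agent) (m : ProbabilityMeasure (D.LocalPolicy i)) :
    ProbabilityMeasure (D.LocalPolicy (f.onAgent i)) :=
  m.map (f.measurable_pushLocal i).aemeasurable

theorem realizationEquiv_pushMixed {m : ProbabilityMeasure (D.LocalPolicy i)}
    {ρ : D.LocalPolicy i} (hρ : RealizationEquiv m ρ) :
    RealizationEquiv (f.pushMixed i m) (f.pushLocal i ρ) := by
  refine fun t => (f.onLocalHist i t).surjective.forall.mpr fun h =>
    (f.onAction i).surjective.forall.mpr fun a => ?_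
  rw [pushMixed, ProbabilityMeasure.toMeasure_map,
    lintegral_map (measurable_reachWeight_mul_apply _ _ _) (f.measurable_pushLocal i)]
  simpa only [reachWeight_pushLocal, pushLocal_apply] using hρ t h a

theorem behaviourLocal_pushMixed (i : D.Agent) (m : ProbabilityMeasure (D.LocalPolicy i)) :
    behaviourLocal (f.onAgent i) (f.pushMixed i m) = f.pushLocal i (behaviourLocal i m) := by
  obtain ⟨ρ, hρ⟩ := exists_realizationEquiv m
  have hpush := f.realizationEquiv_pushMixed hρ
  refine (f.pushLocal_eq_of_forall fun t h a => ?_).symm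
  by_cases hh : Attainable ρ t h
  · rw [behaviourLocal_of_attainable hpush (f.attainable_pushLocal_iff.mpr hh),
      behaviourLocal_of_attainable hρ hh, pushLocal_apply]
  · rw [behaviourLocal_apply_of_not_attainable hpush (mt f.attainable_pushLocal_iff.mp hh),
      behaviourLocal_apply_of_not_attainable hρ hh, Fintype.card_congr (f.onAction i)]

theorem opLocal_onAgent (π : D.Policy) (i : D.Agent) :
    opLocal π (f.onAgent i) = f.pushMixed i (opLocal π i) := by
  refine ProbabilityMeasure.toMeasure_injective ?_
  rw [pushMixed, ProbabilityMeasure.toMeasure_map]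
  have map_eq (m : Measure (D.LocalPolicy i)) :
      m.map (f.pushLocal i) = Measure.mapₗ (f.pushLocal i) m :=
    (Measure.mapₗ_apply_of_measurable (f.measurable_pushLocal i) m).symm
  have map_dirac_push (g : D.Aut) :
      (Measure.dirac (g.push π i)).map (f.pushLocal i) =
        Measure.dirac ((f.comp g).push π (f.onAgent i)) := by
    rw [Measure.map_dirac' (f.measurable_pushLocal i), comp_push, push_apply_onAgent]
  simp only [opLocal, ProbabilityMeasure.coe_mk, map_eq, map_smul, map_sum]
  simp only [← map_eq, map_dirac_push]
  rw [f.comp_bijective.sum_comp fun g => Measure.dirac (g.push π (f.onAgent i))]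

end Aut

theorem isInvariant_symmetrizer (π : D.Policy) : IsInvariant (symmetrizer π) := fun f =>
  funext (f.onAgent.surjective.forall.mpr fun i => by
    simp only [symmetrizer, behaviour, f.push_apply_onAgent, marginal_opDist, f.opLocal_onAgent,
      f.behaviourLocal_pushMixed])

end DecPOMDP

theorem mainTheorem5 (D : DecPOMDP.{u, v, w}) :
    (∀ π : D.Policy,
      DecPOMDP.Corresponds (DecPOMDP.opDist π) (DecPOMDP.symmetrizer π) ∧
      DecPOMDP.IsInvariant (DecPOMDP.symmetrizer π) ∧
      D.JOP π = D.J (DecPOMDP.symmetrizer π)) ∧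
    (∃ Jquot : Quotient D.opSetoid → ℝ, ∀ π : D.Policy, Jquot (Quotient.mk _ π) = D.JOP π) ∧
    ((∃ π : D.Policy, D.IsOPOptimal π) →
      ∃ π : D.Policy, D.IsOPOptimal π ∧ DecPOMDP.IsInvariant π) := by
  refine ⟨fun π => ⟨DecPOMDP.corresponds_behaviour _, DecPOMDP.isInvariant_symmetrizer π,
    DecPOMDP.JOP_eq_J_symmetrizer π⟩, ⟨Quotient.lift D.JOP fun π π' hππ' => ?_, fun _ => rfl⟩, ?_⟩
  · have symmetrizer_eq : DecPOMDP.symmetrizer π = DecPOMDP.symmetrizer π' := hππ'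
    rw [DecPOMDP.JOP_eq_J_symmetrizer, DecPOMDP.JOP_eq_J_symmetrizer, symmetrizer_eq]
  · rintro ⟨π, hπ⟩
    have hinv := DecPOMDP.isInvariant_symmetrizer π
    refine ⟨DecPOMDP.symmetrizer π, fun π' => ?_, hinv⟩
    calc D.JOP π' ≤ D.JOP π := hπ π'
      _ = D.J (DecPOMDP.symmetrizer π) := DecPOMDP.JOP_eq_J_symmetrizer π
      _ = D.JOP (DecPOMDP.symmetrizer π) := (DecPOMDP.JOP_eq_J_of_isInvariant hinv).symm
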